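/- **Setting.** Let $\mathcal S\subset\mathbb R^d$ (Euclidean norm) be a bounded, measurable, convex set with non-empty interior, and $\mathcal A$ a finite set of actions. Consider an entropy-regularized MDP $\langle\mathcal S,\mathcal A,p,r,\gamma,\beta,\pi_0\rangle$ with stochastic transition law $p(\cdot\mid s,a)$, reward $r:\mathcal S\times\mathcal A\to[R_{\min},R_{\max}]$, discount factor $\gamma\in[0,1)$, inverse temperature $\beta>0$ and positive prior policy $\pi_0(a\mid s)$. Assume that, for each action and as functions of the state, $r$ is $L_r$-Lipschitz, $p$ is $L_p$-Lipschitz for the Kantorovich (1-Wasserstein) distance, and $\log\pi_0$ is $L_\kappa$-Lipschitz. For $Q:\mathcal S\times\mathcal A\to\mathbb R$ put $$V_Q(s)=\frac1\beta\log\sum_{a}\pi_0(a\mid s)\,e^{\beta Q(s,a)},\qquad (BQ)(s,a)=r(s,a)+\gamma\,\mathbb E_{s'\sim p(\cdot\mid s,a)}V_Q(s').$$ Let $Q^*=\lim_{k\to\infty}B^k r$ be the optimal soft action-value function, obtained by iterating the soft Bellman equation. Let $Q$ be any function with each $Q(\cdot,a)$ being $L_Q$-Lipschitz, let $V=V_Q$,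 and set $$L_\Delta=L_r+L_Q+\gamma L_p\,(L_Q+\beta^{-1}L_\kappa).$$ **Sampling.** Let $\varepsilon_1,\varepsilon_2,\delta_1,\delta_2>0$ and let $|\mathcal B|\ge1$, $n_{\mathcal S}\ge1$ be integers with $$|\mathcal B|\ \ge\ \Big(\frac{L_\Delta\,\mathrm{diam}(\mathcal S)}{\varepsilon_1}\Big)^{d}\log\frac1{\delta_1},\qquad n_{\mathcal S}\ \ge\ \frac12\Big(\frac{R_{\max}-R_{\min}}{\varepsilon_2(1-\gamma)}\Big)^2\log\frac2{\delta_2}.$$ Draw $|\mathcal B|$ independent states uniformly from $\mathcal S$; let $\mathcal B$ denote the set of pairs $(x,b)$ with $x$ a sampled state and $b\in\mathcal A$. For each such pair draw $n_{\mathcal S}$ next states $x'_1,\dots,x'_{n_{\mathcal S}}$ from $p(\cdot\mid x,b)$, and put $$\hat\Delta(x,b)=r(x,b)+\gamma\,\frac1{n_{\mathcal S}}\sum_{i=1}^{n_{\mathcal S}}V(x'_i)-Q(x,b).$$ Fix $(s,a)\in\mathcal S\times\mathcal A$ and draw $n_{\mathcal S}$ further next states $s'_1,\dots,s'_{n_{\mathcal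 S}}$ from $p(\cdot\mid s,a)$. All next-state samples are independent given the batch states. Consider the bounds $$Q^*(s,a)\le r(s,a)+\gamma\Big(\frac1{n_{\mathcal S}}\sum_{i=1}^{n_{\mathcal S}}V(s'_i)+\frac{\max_{\mathcal B}\hat\Delta+\varepsilon_1+\varepsilon_2}{1-\gamma}\Big),\tag{U}$$ $$Q^*(s,a)\ge r(s,a)+\gamma\Big(\frac1{n_{\mathcal S}}\sum_{i=1}^{n_{\mathcal S}}V(s'_i)+\frac{\min_{\mathcal B}\hat\Delta-\varepsilon_1-\varepsilon_2}{1-\gamma}\Big).\tag{L}$$ **Theorem.** 1. (U) holds with probability at least $1-\delta_1-2\delta_2$, and (L) holds with probability at least $1-\delta_1-2\delta_2$. 2. If moreover the oscillation of $V$ is at most $\frac{R_{\max}-R_{\min}}{1-\gamma}$, i.e. $V(x)-V(y)\le\frac{R_{\max}-R_{\min}}{1-\gamma}$ for all $x,y\in\mathcal S$ (for instance if $Q$ takes values in $\big[\frac{R_{\min}}{1-\gamma},\frac{R_{\max}}{1-\gamma}\big]$), then (U) and (L) hold simultaneously with probability at least $1-\delta_1-2\delta_2$. -/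

import Mathlib

open MeasureTheory ProbabilityTheory Filter
open scoped ENNReal NNReal

noncomputable section

/-- An entropy-regularized Markov decision process with measurable state space `X` and finite
action set `A`: transition law `p a s = p(· | s, a)`, reward `r`, discount factor `γ ∈ [0, 1)`,
inverse temperature `β > 0` and prior policy `π₀ s a = π₀(a | s)`. -/
structure EntRegMDP (X A : Type*) [MeasurableSpace X] [Fintype A] where
  p : A → Kernel X X
  markov : ∀ a, IsMarkovKernel (p a)
  r : X → A → ℝ
  measurable_r : ∀ a, Measurable fun s => r s a
  γ : ℝ
  γ_nonneg : 0 ≤ γ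
  γ_lt_one : γ < 1
  β : ℝ
  β_pos : 0 < β
  π₀ : X → A → ℝ
  measurable_π₀ : ∀ a, Measurable fun s => π₀ s a
  π₀_nonneg : ∀ s a, 0 ≤ π₀ s a
  π₀_sum : ∀ s, ∑ a, π₀ s a = 1

namespace EntRegMDP

variable {X A : Type*} [MeasurableSpace X] [Fintype A]

instance (M : EntRegMDP X A) (a : A) : IsMarkovKernel (M.p a) := M.markov a

/-- The soft state-value function `V(s) = β⁻¹ log 𝔼_{a ∼ π₀(·|s)} exp (β Q(s, a))` of `Q`. -/
def softValue (M : EntRegMDP X A) (Q : X → A → ℝ) (s : X) : ℝ :=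
  1 / M.β * Real.log (∑ a, M.π₀ s a * Real.exp (M.β * Q s a))

/-- The soft Bellman operator `(B Q)(s, a) = r(s, a) + γ 𝔼_{s' ∼ p(·|s, a)} V(s')`. -/
def bellman (M : EntRegMDP X A) (Q : X → A → ℝ) (s : X) (a : A) : ℝ :=
  M.r s a + M.γ * ∫ s', M.softValue Q s' ∂(M.p a s)

/-- The optimal soft action-value function `Q*`, obtained by iterating the soft Bellman equation
`Q* = B Q*` from `Q⁽⁰⁾ = r`. -/
def optimalQ (M : EntRegMDP X A) (s : X) (a : A) : ℝ :=
  limUnder atTop fun n : ℕ => (M.bellman^[n] M.r) s a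

/-- The empirical mean `(1 / n) ∑ᵢ V(s'ᵢ)` of the soft state value over `n` next-state samples. -/
def empValue (M : EntRegMDP X A) (Q : X → A → ℝ) {n : ℕ} (y : Fin n → X) : ℝ :=
  1 / (n : ℝ) * ∑ i, M.softValue Q (y i)

/-- `Δ̂(s, a) = r(s, a) + γ (1 / n) ∑ᵢ V(s'ᵢ) - Q(s, a)`, computed from next-state samples `y`. -/
def empDelta (M : EntRegMDP X A) (Q : X → A → ℝ) {n : ℕ} (s : X) (a : A) (y : Fin n → X) : ℝ :=
  M.r s a + M.γ * M.empValue Q y - Q s a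

/-- Given a state `s`, draw for every action `a` independently `n` next states from
`p(· | s, a)`. -/
def nextStates (M : EntRegMDP X A) (n : ℕ) : Kernel X (A → Fin n → X) where
  toFun s := Measure.pi fun a => Measure.pi fun _ : Fin n => M.p a s
  measurable' := by
    have key : ∀ a, Measurable fun s => Measure.pi fun _ : Fin n => M.p a s := by
      intro a
      refine Measurable.measure_of_isPiSystem_of_isProbabilityMeasure generateFrom_pi.symm
        isPiSystem_pi ?_
      rintro _ ⟨t, ht, rfl⟩
      simp only [Measure.pi_pi]
      exact Finset.measurable_fun_prod _ fun i _ =>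
        (M.p a).measurable_coe (ht i (Set.mem_univ i))
    refine Measurable.measure_of_isPiSystem_of_isProbabilityMeasure generateFrom_pi.symm
      isPiSystem_pi ?_
    rintro _ ⟨t, ht, rfl⟩
    simp only [Measure.pi_pi]
    exact Finset.measurable_fun_prod _ fun a _ =>
      (Measure.measurable_coe (show MeasurableSet (t a) from ht a (Set.mem_univ a))).comp (key a)

instance (M : EntRegMDP X A) (n : ℕ) : IsMarkovKernel (M.nextStates n) :=
  ⟨fun s => by
    change IsProbabilityMeasure (Measure.pi fun a => Measure.pi fun _ : Fin n => M.p a s)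
    infer_instance⟩

end EntRegMDP

/-- The uniform distribution on a subset of Euclidean space, as a measure on that subset. -/
def uniformState {d : ℕ} (S : Set (EuclideanSpace ℝ (Fin d))) : Measure S :=
  (ProbabilityTheory.cond volume S).comap Subtype.val

/-- The data of the sampling scheme. The first component is a batch of `N` sampled states, each
with `n` next-state samples for every action; the second consists of `n` next-state samples for
the state-action pair at which the value function is to be bounded. -/
abbrev SampleSpace (X A : Type*) (N n : ℕ) : Type _ :=
  (Fin N → X × (A → Fin n → X)) × (Fin n → X)

namespace EntRegMDP

/-- The law of the samples: the batch states are independent and uniform on `S`; given the batch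
states, all next states are independent, those belonging to a pair `(x, b)` having law
`p(· | x, b)`. The pair to be bounded is `(s, a)`. -/
def sampleLaw {d : ℕ} {S : Set (EuclideanSpace ℝ (Fin d))} {A : Type*} [Fintype A]
    (M : EntRegMDP S A) (N n : ℕ) (s : S) (a : A) : Measure (SampleSpace S A N n) :=
  (Measure.pi fun _ : Fin N => uniformState S ⊗ₘ M.nextStates n).prod
    (Measure.pi fun _ : Fin n => M.p a s)

variable {X A : Type*} [MeasurableSpace X] [Fintype A]

/-- The maximum of `Δ̂` over the batch (all sampled states, all actions). -/
def batchMax (M : EntRegMDP X A) (Q : X → A → ℝ) {N n : ℕ} (ω : SampleSpace X A N n) : ℝ :=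
  ⨆ k : Fin N × A, M.empDelta Q (ω.1 k.1).1 k.2 ((ω.1 k.1).2 k.2)

/-- The minimum of `Δ̂` over the batch (all sampled states, all actions). -/
def batchMin (M : EntRegMDP X A) (Q : X → A → ℝ) {N n : ℕ} (ω : SampleSpace X A N n) : ℝ :=
  ⨅ k : Fin N × A, M.empDelta Q (ω.1 k.1).1 k.2 ((ω.1 k.1).2 k.2)

/-- The sampled upper bound on `Q*(s, a)`, with total slack `ε`, holds for the sample `ω`. -/
def UpperBound (M : EntRegMDP X A) (Q : X → A → ℝ) (s : X) (a : A) (ε : ℝ) {N n : ℕ}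
    (ω : SampleSpace X A N n) : Prop :=
  M.optimalQ s a ≤
    M.r s a + M.γ * (M.empValue Q ω.2 + (M.batchMax Q ω + ε) / (1 - M.γ))

/-- The sampled lower bound on `Q*(s, a)`, with total slack `ε`, holds for the sample `ω`. -/
def LowerBound (M : EntRegMDP X A) (Q : X → A → ℝ) (s : X) (a : A) (ε : ℝ) {N n : ℕ}
    (ω : SampleSpace X A N n) : Prop :=
  M.r s a + M.γ * (M.empValue Q ω.2 + (M.batchMin Q ω - ε) / (1 - M.γ)) ≤
    M.optimalQ s a

end EntRegMDP

/-- The Kantorovich (1-Wasserstein) distance, as a supremum over `1`-Lipschitz functions. -/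
def kantorovichDist {X : Type*} [PseudoEMetricSpace X] [MeasurableSpace X] (μ ν : Measure X) :
    ℝ≥0∞ :=
  ⨆ (f : X → ℝ) (_ : LipschitzWith 1 f), ENNReal.ofReal |∫ x, f x ∂μ - ∫ x, f x ∂ν|

namespace EntRegMDP

/-- The MDP has `L_r`-Lipschitz rewards, `L_p`-Lipschitz dynamics (for the Kantorovich distance)
and a positive prior policy with `L_κ`-Lipschitz logarithm, as functions of the state. -/
structure IsLipschitz {X A : Type*} [PseudoEMetricSpace X] [MeasurableSpace X] [Fintype A]
    (M : EntRegMDP X A) (Lr Lp Lκ : ℝ≥0) : Prop where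
  reward : ∀ a, LipschitzWith Lr fun s => M.r s a
  dynamics : ∀ a s s', kantorovichDist (M.p a s) (M.p a s') ≤ Lp * edist s s'
  prior_pos : ∀ s a, 0 < M.π₀ s a
  log_prior : ∀ a, LipschitzWith Lκ fun s => Real.log (M.π₀ s a)

/-- `L_Δ = L_r + L_Q + γ L_p (L_Q + β⁻¹ L_κ)`. -/
def lipDelta {X A : Type*} [MeasurableSpace X] [Fintype A] (M : EntRegMDP X A)
    (Lr Lp Lκ LQ : ℝ≥0) : ℝ :=
  Lr + LQ + M.γ * Lp * (LQ + M.β⁻¹ * Lκ)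

end EntRegMDP

end

/-! Write V* for the soft value of Q*, Δ_W = r - Q + γ𝔼W, and g for the mean of V* - W under p(· |
s, a).

Deterministic core (`exists_gap_le_delta`): the soft value is monotone and commutes with adding
constants, so the least K with V* ≤ V + K satisfies K ≤ sup Δ_W + γK whenever V* ≤ W + K. Since g ≤
K, this gives (1 - γ)g ≤ sup Δ_W. Taking W = V yields the exact counterpart of (U); (L) is the same
statement for -r, -Q, -V.

Sampling: Δ_W is L_Δ-Lipschitz, so it is within ε₁ of its supremum on a shrunken copy of the convex
set S, which a uniform batch misses with probability at most δ₁. Because (U) involves a maximum, one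
accurately sampled batch state suffices, and Hoeffding's inequality needs no union bound over the
batch. Each side fails with probability at most δ₁ + δ₂.

Hoeffding's inequality needs a function of oscillation at most (Rmax - Rmin)/(1 - γ), which V*
satisfies but V may not. For one side, V is therefore truncated from above at a height that keeps V*
≤ W + K (`exists_truncation_gap_le_delta`); since W ≤ V and the right side of (U) is monotone, the
bound for W implies the one for V.

Under the oscillation assumption both sides can use W = V, hence the same Δ_V and the same level w.
Connectedness gives a point near which neither bad set reaches, and the bad sets are disjoint.
Superadditivity of u ↦ u ^ N then lets a single δ₁ cover both
(`uniformState_real_forall_lt_pow_add_pow_le`). -/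

/-! ### Concentration of empirical means and detection by a batch. -/

/-- **Hoeffding's inequality** for the lower tail of the mean of `n` independent samples of a
function of bounded oscillation. -/
lemma pi_real_mean_lt_le {X : Type*} [MeasurableSpace X] (μ : Measure X) [IsProbabilityMeasure μ]
    {W : X → ℝ} (hW : Measurable W) {R ε δ : ℝ} (hosc : ∀ x y, W x - W y ≤ R) (hε : 0 < ε)
    (hδ : 0 < δ) {n : ℕ} (hn₀ : 1 ≤ n) (hn : 1 / 2 * (R / ε) ^ 2 * Real.log (2 / δ) ≤ n) :
    (Measure.pi fun _ : Fin n => μ).real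
      {y | 1 / (n : ℝ) * ∑ i, W (y i) < ∫ x, W x ∂μ - ε} ≤ δ / 2 := by
  obtain ⟨x₀⟩ := nonempty_of_isProbabilityMeasure μ
  have hR : 0 ≤ R := by simpa using hosc x₀ x₀
  have hnpos : (0 : ℝ) < n := by exact_mod_cast hn₀
  have hbdd : BddBelow (Set.range W) := ⟨W x₀ - R, by
    rintro _ ⟨x, rfl⟩; linarith [hosc x₀ x]⟩
  have : Nonempty X := ⟨x₀⟩
  set c := ⨅ x, W x with hc
  have hIcc : ∀ x, W x ∈ Set.Icc c (c + R) := fun x =>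
    ⟨ciInf_le hbdd x, by
      have : W x - R ≤ c := le_ciInf fun y => by linarith [hosc x y]
      linarith⟩
  -- For R = 0 the variance proxy vanishes and the sub-Gaussian bound would divide by zero; but then
  -- W is constant and the event is empty.
  rcases hR.eq_or_lt with rfl | hRpos
  · have hconst : ∀ x, W x = c := fun x => le_antisymm (by simpa using (hIcc x).2) (hIcc x).1
    have : {y : Fin n → X | 1 / (n : ℝ) * ∑ i, W (y i) < ∫ x, W x ∂μ - ε} = ∅ := by
      ext y
      simp only [hconst, Finset.sum_const, Finset.card_univ, Fintype.card_fin, nsmul_eq_mul,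
        integral_const, probReal_univ, smul_eq_mul, Set.mem_ofPred_eq, Set.mem_empty_iff_false,
        iff_false, not_lt]
      field_simp
      linarith
    rw [this]
    simp only [measureReal_empty]
    positivity
  -- Passing to -W turns the lower tail into the upper tail that the sub-Gaussian estimate controls.
  have hsub : HasSubgaussianMGF (fun x => -W x - ∫ x, -W x ∂μ) ((‖-c - -(c + R)‖₊ / 2) ^ 2) μ :=
    hasSubgaussianMGF_of_mem_Icc hW.neg.aemeasurable (Eventually.of_forall fun x =>
      ⟨neg_le_neg (hIcc x).2, neg_le_neg (hIcc x).1⟩)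
  have hmeas : Measurable fun x => -W x - ∫ x, -W x ∂μ := hW.neg.sub_const _
  have hsub' : ∀ i ∈ (Finset.univ : Finset (Fin n)),
      HasSubgaussianMGF (fun y : Fin n → X => -W (y i) - ∫ x, -W x ∂μ)
        ((‖-c - -(c + R)‖₊ / 2) ^ 2) (Measure.pi fun _ : Fin n => μ) := by
    intro i _
    have hmp := measurePreserving_eval (fun _ : Fin n => μ) i
    refine HasSubgaussianMGF.of_map (Y := fun y : Fin n → X => y i)
      (X := fun x => -W x - ∫ x, -W x ∂μ) hmp.measurable.aemeasurable ?_
    rw [hmp.map_eq]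
    exact hsub
  have key := HasSubgaussianMGF.measure_sum_ge_le_of_iIndepFun
    (iIndepFun_pi (μ := fun _ : Fin n => μ) (X := fun _ x => -W x - ∫ x, -W x ∂μ)
      fun _ => hmeas.aemeasurable) hsub' (ε := n * ε) (by positivity)
  refine (measureReal_mono ?_).trans (key.trans ?_)
  · intro y hy
    simp only [Set.mem_ofPred_eq] at hy ⊢
    rw [Finset.sum_sub_distrib, Finset.sum_neg_distrib, integral_neg]
    simp only [Finset.sum_const, Finset.card_univ, Fintype.card_fin, nsmul_eq_mul]
    rw [one_div, inv_mul_lt_iff₀ hnpos] at hy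
    linarith
  · have h1 : -c - -(c + R) = R := by ring
    rw [h1, ← Real.exp_log (show 0 < δ / 2 by positivity), Real.exp_le_exp]
    have h2 : Real.log (2 / δ) = -Real.log (δ / 2) := by
      rw [← Real.log_inv, inv_div]
    simp only [Finset.sum_const, Finset.card_univ, Fintype.card_fin, nsmul_eq_mul, NNReal.coe_mul,
      NNReal.coe_natCast, NNReal.coe_pow, NNReal.coe_div, coe_nnnorm, Real.norm_of_nonneg hR,
      NNReal.coe_ofNat]
    rw [h2] at hn
    rw [div_le_iff₀ (by positivity)]
    have h3 : 1 / 2 * (R / ε) ^ 2 * -Real.log (δ / 2) * (n * ε ^ 2) ≤ n * (n * ε ^ 2) :=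
      mul_le_mul_of_nonneg_right hn (by positivity)
    have h4 : 1 / 2 * (R / ε) ^ 2 * -Real.log (δ / 2) * (n * ε ^ 2)
        = -(Real.log (δ / 2) * (2 * (n * (R / 2) ^ 2))) := by
      field_simp
    rw [h4] at h3
    linarith

/-- Convexity of the power on the segment from u to 1. With u the mass of the states of no use and η
the chance that a useful state is badly sampled, N draws pay for η only once. -/
lemma pow_convexCombination_one_le {u η : ℝ} (hu : 0 ≤ u) (hη₀ : 0 ≤ η) (hη₁ : η ≤ 1) (N : ℕ) :
    (u + (1 - u) * η) ^ N ≤ u ^ N + η := by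
  have h := (convexOn_pow N).2 (Set.mem_Ici.2 hu) (Set.mem_Ici.2 (zero_le_one (α := ℝ)))
    (sub_nonneg.2 hη₁) hη₀ (by ring)
  simp only [smul_eq_mul, one_pow, mul_one] at h
  calc (u + (1 - u) * η) ^ N = ((1 - η) * u + η) ^ N := by ring
    _ ≤ (1 - η) * u ^ N + η := h
    _ ≤ u ^ N + η := by nlinarith [pow_nonneg hu N]

namespace EntRegMDP

variable {X A : Type*} [MeasurableSpace X] [Fintype A]

lemma nextStates_real_eval (M : EntRegMDP X A) (n : ℕ) (x : X) (b : A) {T : Set (Fin n → X)}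
    (hT : MeasurableSet T) :
    (M.nextStates n x).real {y | y b ∈ T} = (Measure.pi fun _ : Fin n => M.p b x).real T :=
  (measurePreserving_eval (fun a => Measure.pi fun _ : Fin n => M.p a x) b).measureReal_preimage
    hT.nullMeasurableSet

/-- A batch of `N` states with `n` next-state samples per action detects that
`h + γ 𝔼 W` exceeds `τ` somewhere, unless the batch misses the corresponding superlevel set
or the empirical mean is off by `ε` at a point of it. -/
lemma pi_real_batch_lt_le (M : EntRegMDP X A) (μ : Measure X) [IsProbabilityMeasure μ]
    {W : X → ℝ} (hW : Measurable W) {h : X → A → ℝ} (hh : ∀ b, Measurable fun x => h x b)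
    {R ε δ : ℝ} (hosc : ∀ x y, W x - W y ≤ R) (hε : 0 < ε) (hδ : 0 < δ) (hδ₂ : δ ≤ 2)
    (N : ℕ) {n : ℕ} (hn₀ : 1 ≤ n) (hn : 1 / 2 * (R / ε) ^ 2 * Real.log (2 / δ) ≤ n) (τ : ℝ) :
    (Measure.pi fun _ : Fin N => μ ⊗ₘ M.nextStates n).real
      {z | ∀ i b, h (z i).1 b + M.γ * (1 / (n : ℝ) * ∑ j, W ((z i).2 b j)) < τ - M.γ * ε} ≤
    μ.real {x | ∀ b, h x b + M.γ * ∫ x', W x' ∂(M.p b x) < τ} ^ N + δ / 2 := by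
  set B : Set X := {x | ∀ b, h x b + M.γ * ∫ x', W x' ∂(M.p b x) < τ} with hB
  set G : Set (X × (A → Fin n → X)) :=
    {q | ∀ b, h q.1 b + M.γ * (1 / (n : ℝ) * ∑ j, W (q.2 b j)) < τ - M.γ * ε} with hG
  have hmean : Measurable fun y : Fin n → X => 1 / (n : ℝ) * ∑ j, W (y j) :=
    (Finset.measurable_fun_sum _ fun j _ => hW.comp (measurable_pi_apply j)).const_mul _
  have hBm : MeasurableSet B := by
    simp only [hB, Set.ofPred_forall]
    refine MeasurableSet.iInter fun b => measurableSet_lt ?_ measurable_const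
    exact (hh b).add ((hW.stronglyMeasurable.integral_kernel (κ := M.p b)).measurable.const_mul _)
  have hGm : MeasurableSet G := by
    simp only [hG, Set.ofPred_forall]
    refine MeasurableSet.iInter fun b => measurableSet_lt ?_ measurable_const
    exact ((hh b).comp measurable_fst).add
      ((hmean.comp ((measurable_pi_apply b).comp measurable_snd)).const_mul _)
  have hbox : {z : Fin N → X × (A → Fin n → X) |
      ∀ i b, h (z i).1 b + M.γ * (1 / (n : ℝ) * ∑ j, W ((z i).2 b j)) < τ - M.γ * ε} =
      Set.univ.pi fun _ => G := by
    ext z; simp [hG]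
  rw [hbox, measureReal_def, Measure.pi_pi, Finset.prod_const, Finset.card_univ, Fintype.card_fin,
    ENNReal.toReal_pow, ← measureReal_def]
  -- At x ∉ B some single action b reaches τ; only the samples of that b matter, and they must
  -- underestimate the mean by more than ε.
  have hsec : ∀ x ∉ B, (M.nextStates n x).real {y | (x, y) ∈ G} ≤ δ / 2 := by
    intro x hx
    simp only [hB, Set.mem_ofPred_eq, not_forall, not_lt] at hx
    obtain ⟨b, hb⟩ := hx
    refine le_trans ?_ (pi_real_mean_lt_le (M.p b x) hW hosc hε hδ hn₀ hn)
    rw [← M.nextStates_real_eval n x b (measurableSet_lt hmean measurable_const)]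
    refine measureReal_mono fun y hy => ?_
    have h1 : h x b + M.γ * (1 / (n : ℝ) * ∑ j, W (y b j)) < τ - M.γ * ε := hy b
    by_contra h2
    simp only [Set.mem_ofPred_eq, not_lt] at h2
    have := mul_le_mul_of_nonneg_left h2 M.γ_nonneg
    linarith
  have hν : (μ ⊗ₘ M.nextStates n).real G ≤ μ.real B + (1 - μ.real B) * (δ / 2) := by
    have hle : (μ ⊗ₘ M.nextStates n) G ≤ μ B + ENNReal.ofReal (δ / 2) * μ Bᶜ := by
      rw [Measure.compProd_apply hGm, ← lintegral_add_compl _ hBm]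
      gcongr
      · calc ∫⁻ x in B, M.nextStates n x (Prod.mk x ⁻¹' G) ∂μ ≤ ∫⁻ x in B, 1 ∂μ :=
            lintegral_mono fun x => prob_le_one
          _ = μ B := by simp
      · calc ∫⁻ x in Bᶜ, M.nextStates n x (Prod.mk x ⁻¹' G) ∂μ
            ≤ ∫⁻ x in Bᶜ, ENNReal.ofReal (δ / 2) ∂μ := by
              refine setLIntegral_mono measurable_const fun x hx => ?_
              rw [← ofReal_measureReal]
              exact ENNReal.ofReal_le_ofReal (hsec x hx)
          _ = ENNReal.ofReal (δ / 2) * μ Bᶜ := by simp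
    have hc : μ.real Bᶜ = 1 - μ.real B := probReal_compl_eq_one_sub hBm
    have := ENNReal.toReal_mono (by finiteness) hle
    rw [ENNReal.toReal_add (by finiteness) (by finiteness), ENNReal.toReal_mul,
      ENNReal.toReal_ofReal (by positivity), ← measureReal_def, ← measureReal_def,
      ← measureReal_def, hc] at this
    linarith
  exact (pow_le_pow_left₀ measureReal_nonneg hν N).trans
    (pow_convexCombination_one_le measureReal_nonneg (by positivity) (by linarith) N)

end EntRegMDP

/-! ### Uniform samples hitting a neighbourhood in a convex body. -/

section UniformState

variable {d : ℕ} {S : Set (EuclideanSpace ℝ (Fin d))}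

lemma uniformState_apply (hS : MeasurableSet S) (T : Set S) :
    uniformState S T = (volume S)⁻¹ * volume (Subtype.val '' T) := by
  have he := MeasurableEmbedding.subtype_coe hS
  rw [uniformState, he.comap_apply, cond_apply hS, Set.inter_eq_self_of_subset_right]
  simp

lemma volume_pos_of_interior_nonempty (hS_int : (interior S).Nonempty) : volume S ≠ 0 :=
  (Measure.measure_pos_of_nonempty_interior volume hS_int).ne'

lemma isProbabilityMeasure_uniformState (hS_bdd : Bornology.IsBounded S)
    (hS_int : (interior S).Nonempty) (hS_meas : MeasurableSet S) :
    IsProbabilityMeasure (uniformState S) := by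
  refine ⟨?_⟩
  rw [uniformState_apply hS_meas, Set.image_univ, Subtype.range_coe]
  exact ENNReal.inv_mul_cancel (volume_pos_of_interior_nonempty hS_int) hS_bdd.measure_lt_top.ne

/-- A set that contains a copy of the convex set `S`, shrunk by the factor `t` towards `x₀`,
carries at least the fraction `t ^ d` of the mass of the uniform distribution. -/
lemma pow_le_uniformState_real (hS_bdd : Bornology.IsBounded S) (hS_conv : Convex ℝ S)
    (hS_int : (interior S).Nonempty) (hS_meas : MeasurableSet S) {t : ℝ} (ht₀ : 0 ≤ t)
    (ht₁ : t ≤ 1) (x₀ : S) {T : Set S}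
    (hT : ∀ x : S, dist x x₀ ≤ t * Metric.diam S → x ∈ T) : t ^ d ≤ (uniformState S).real T := by
  have := isProbabilityMeasure_uniformState hS_bdd hS_int hS_meas
  -- The homothety stays in S by convexity, moves points to within t · diam S of x₀, and scales
  -- volume by t ^ d.
  have hsub : AffineMap.homothety (x₀ : EuclideanSpace ℝ (Fin d)) t '' S ⊆ Subtype.val '' T := by
    rintro _ ⟨y, hy, rfl⟩
    have hmem : AffineMap.homothety (x₀ : EuclideanSpace ℝ (Fin d)) t y ∈ S := by
      rw [AffineMap.homothety_eq_lineMap]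
      exact hS_conv.lineMap_mem x₀.2 hy ⟨ht₀, ht₁⟩
    refine ⟨⟨_, hmem⟩, hT _ ?_, rfl⟩
    rw [Subtype.dist_eq]
    simp only [dist_homothety_center, Real.norm_of_nonneg ht₀]
    gcongr
    exact Metric.dist_le_diam_of_mem hS_bdd x₀.2 hy
  have hvol := measure_mono (μ := volume) hsub
  rw [Measure.addHaar_image_homothety, finrank_euclideanSpace_fin, abs_of_nonneg (by positivity)]
    at hvol
  have hle : ENNReal.ofReal (t ^ d) ≤ uniformState S T := by
    rw [uniformState_apply hS_meas, mul_comm]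
    refine (ENNReal.le_div_iff_mul_le (Or.inl (volume_pos_of_interior_nonempty hS_int))
      (Or.inl hS_bdd.measure_lt_top.ne)).2 hvol
  exact (ENNReal.ofReal_le_iff_le_toReal (by finiteness)).1 hle

/-- If for every `η > 0` the set `T` contains a neighbourhood of radius `(ε - η) / L` of some
point, then `N ≥ (L diam S / ε) ^ d log (1 / δ)` uniform samples all miss `T` with probability
at most `δ`. -/
lemma one_sub_uniformState_real_pow_le (hS_bdd : Bornology.IsBounded S) (hS_conv : Convex ℝ S)
    (hS_int : (interior S).Nonempty) (hS_meas : MeasurableSet S) {L ε δ : ℝ} (hL : 0 ≤ L)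
    (hε : 0 < ε) (hδ : 0 < δ) {N : ℕ} (hN₀ : 1 ≤ N)
    (hN : (L * Metric.diam S / ε) ^ d * Real.log (1 / δ) ≤ N) {T : Set S}
    (hT : ∀ η > 0, ∃ x₀ : S, ∀ x : S, L * dist x x₀ ≤ ε - η → x ∈ T) :
    (1 - (uniformState S).real T) ^ N ≤ δ := by
  have := isProbabilityMeasure_uniformState hS_bdd hS_int hS_meas
  have hT₁ : (uniformState S).real T ≤ 1 := measureReal_le_one
  have step : ∀ t : ℝ, 0 ≤ t → t ≤ 1 → t * (L * Metric.diam S) < ε →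
      t ^ d ≤ (uniformState S).real T := by
    intro t ht₀ ht₁ ht
    obtain ⟨x₀, hx₀⟩ := hT (ε - t * (L * Metric.diam S)) (by linarith)
    refine pow_le_uniformState_real hS_bdd hS_conv hS_int hS_meas ht₀ ht₁ x₀ fun x hx => hx₀ x ?_
    nlinarith [mul_le_mul_of_nonneg_left hx hL]
  -- If L · diam S < ε, the neighbourhood is all of S. This also covers L = 0 and diam S = 0, where
  -- t₁ below would not make sense.
  rcases lt_or_ge (L * Metric.diam S) ε with hlt | hge
  · have h1 := step 1 zero_le_one le_rfl (by linarith)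
    rw [one_pow] at h1
    rw [le_antisymm hT₁ h1, sub_self, zero_pow (by omega)]
    exact hδ.le
  · have hD : 0 < L * Metric.diam S := hε.trans_le hge
    set t₁ := ε / (L * Metric.diam S) with ht₁
    have ht₁pos : 0 < t₁ := by positivity
    have ht₁le : t₁ ≤ 1 := (div_le_one hD).2 hge
    have hq : t₁ ^ d ≤ (uniformState S).real T := by
      -- The supremum behind T need not be attained, so only t < t₁ is available; the bound at t₁
      -- follows in the limit.
      have hlim : Tendsto (fun t : ℝ => t ^ d) (nhdsWithin t₁ (Set.Iio t₁)) (nhds (t₁ ^ d)) :=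
        ((continuous_pow d).tendsto t₁).mono_left nhdsWithin_le_nhds
      refine le_of_tendsto hlim ?_
      filter_upwards [Ioo_mem_nhdsLT ht₁pos] with t ht
      exact step t ht.1.le (ht.2.le.trans ht₁le) ((lt_div_iff₀ hD).1 ht.2)
    have hpow : (L * Metric.diam S / ε) ^ d * t₁ ^ d = 1 := by
      rw [← mul_pow, ht₁, div_mul_div_cancel₀ hε.ne', div_self hD.ne', one_pow]
    have hlog : Real.log (1 / δ) ≤ N * t₁ ^ d := by
      have := mul_le_mul_of_nonneg_right hN (pow_nonneg ht₁pos.le d)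
      rwa [mul_right_comm, hpow, one_mul] at this
    calc (1 - (uniformState S).real T) ^ N ≤ (Real.exp (-t₁ ^ d)) ^ N := by
          refine pow_le_pow_left₀ (by linarith) ?_ N
          linarith [Real.add_one_le_exp (-t₁ ^ d)]
      _ = Real.exp (-(N * t₁ ^ d)) := by rw [← Real.exp_nat_mul]; ring_nf
      _ ≤ Real.exp (-Real.log (1 / δ)) := by gcongr
      _ = δ := by rw [one_div, Real.log_inv, neg_neg, Real.exp_log hδ]

end UniformState

/-- On a preconnected space, a finite family of continuous functions whose maximum reaches above
and whose minimum reaches below `w` does both at some common point, up to `η`. -/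
lemma exists_point_ge_and_le {X A : Type*} [TopologicalSpace X] [PreconnectedSpace X] [Finite A]
    {F : X → A → ℝ} (hF : ∀ b, Continuous fun x => F x b) {w : ℝ}
    (hge : ∀ η > 0, ∃ x b, w - η ≤ F x b) (hle : ∀ η > 0, ∃ x b, F x b ≤ w + η) {η : ℝ}
    (hη : 0 < η) : ∃ x, (∃ b, w - η ≤ F x b) ∧ ∃ b, F x b ≤ w + η := by
  -- Otherwise the open sets where the maximum is below w - η and where the minimum is above w + η
  -- cover the space. Both are nonempty, so they would meet.
  by_contra! hcon
  have hU : IsOpen {x | ∀ b, F x b < w - η} := by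
    simp only [Set.ofPred_forall]
    exact isOpen_iInter_of_finite fun b => isOpen_lt (hF b) continuous_const
  have hV : IsOpen {x | ∀ b, w + η < F x b} := by
    simp only [Set.ofPred_forall]
    exact isOpen_iInter_of_finite fun b => isOpen_lt continuous_const (hF b)
  obtain ⟨x, b, hx⟩ := hge η hη
  obtain ⟨y, c, hy⟩ := hle η hη
  obtain ⟨z, -, hz₁, hz₂⟩ := isPreconnected_univ _ _ hU hV (fun z _ => by
      by_cases hz : ∃ b, w - η ≤ F z b
      · exact Or.inr (hcon z hz)
      · push Not at hz
        exact Or.inl hz)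
    ⟨y, Set.mem_univ y, fun b => by
      by_contra! h
      exact absurd (hcon y ⟨b, h⟩ c) (not_lt.2 hy)⟩
    ⟨x, Set.mem_univ x, hcon x ⟨b, hx⟩⟩
  linarith [hz₁ b, hz₂ b]

/-! ### Soft value, soft Bellman operator and its fixed point Q*. -/

namespace EntRegMDP

section SoftValue

variable {X A : Type*} [MeasurableSpace X] [Fintype A] (M : EntRegMDP X A)

lemma sum_prior_mul_exp_pos (Q : X → A → ℝ) (s : X) :
    0 < ∑ a, M.π₀ s a * Real.exp (M.β * Q s a) := by
  have hnn : ∀ a ∈ Finset.univ, 0 ≤ M.π₀ s a * Real.exp (M.β * Q s a) := fun a _ =>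
    mul_nonneg (M.π₀_nonneg s a) (Real.exp_pos _).le
  refine (Finset.sum_nonneg hnn).lt_of_ne' fun h => ?_
  rw [Finset.sum_eq_zero_iff_of_nonneg hnn] at h
  have hz : ∑ a, M.π₀ s a = 0 := Finset.sum_eq_zero fun a ha =>
    (mul_eq_zero.1 (h a ha)).resolve_right (Real.exp_pos _).ne'
  exact one_ne_zero ((M.π₀_sum s).symm.trans hz)

/-- Termwise comparison inside the log-sum-exp. Allowing two states as well as two functions serves
both monotonicity in Q (same state) and the Lipschitz bound (same Q). -/
lemma softValue_le_add_of_forall_mul_exp_le {Q Q' : X → A → ℝ} {x y : X} {C : ℝ}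
    (h : ∀ a, M.π₀ x a * Real.exp (M.β * Q x a) ≤
      M.π₀ y a * Real.exp (M.β * (Q' y a + C))) :
    M.softValue Q x ≤ M.softValue Q' y + C := by
  have hsum : ∑ a, M.π₀ x a * Real.exp (M.β * Q x a) ≤
      (∑ a, M.π₀ y a * Real.exp (M.β * Q' y a)) * Real.exp (M.β * C) := by
    rw [Finset.sum_mul]
    refine Finset.sum_le_sum fun a _ => (h a).trans_eq ?_
    rw [mul_add, Real.exp_add, mul_assoc]
  have hlog := Real.log_le_log (M.sum_prior_mul_exp_pos Q x) hsum
  rw [Real.log_mul (M.sum_prior_mul_exp_pos Q' y).ne' (Real.exp_pos _).ne', Real.log_exp] at hlog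
  have hβ := M.β_pos
  calc M.softValue Q x
      ≤ 1 / M.β * (Real.log (∑ a, M.π₀ y a * Real.exp (M.β * Q' y a)) + M.β * C) :=
        mul_le_mul_of_nonneg_left hlog (by positivity)
    _ = M.softValue Q' y + C := by rw [softValue]; field_simp

lemma softValue_le_add {Q Q' : X → A → ℝ} {x : X} {C : ℝ} (h : ∀ a, Q x a ≤ Q' x a + C) :
    M.softValue Q x ≤ M.softValue Q' x + C :=
  M.softValue_le_add_of_forall_mul_exp_le fun a =>
    mul_le_mul_of_nonneg_left (Real.exp_le_exp.2 (mul_le_mul_of_nonneg_left (h a) M.β_pos.le))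
      (M.π₀_nonneg x a)

lemma softValue_const (c : ℝ) (s : X) : M.softValue (fun _ _ => c) s = c := by
  rw [softValue, ← Finset.sum_mul, M.π₀_sum, one_mul, Real.log_exp, ← mul_assoc,
    one_div_mul_cancel M.β_pos.ne', one_mul]

lemma softValue_le {Q : X → A → ℝ} {x : X} {C : ℝ} (h : ∀ a, Q x a ≤ C) :
    M.softValue Q x ≤ C := by
  simpa [softValue_const] using M.softValue_le_add (Q' := fun _ _ => 0) (C := C) (by simpa using h)

lemma le_softValue {Q : X → A → ℝ} {x : X} {c : ℝ} (h : ∀ a, c ≤ Q x a) :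
    c ≤ M.softValue Q x := by
  simpa [softValue_const] using
    M.softValue_le_add (Q := fun _ _ => c) (Q' := Q) (C := 0) (by simpa using h)

lemma measurable_softValue {Q : X → A → ℝ} (hQ : ∀ a, Measurable fun s => Q s a) :
    Measurable (M.softValue Q) :=
  (Real.measurable_log.comp (Finset.measurable_fun_sum _ fun a _ =>
    (M.measurable_π₀ a).mul (Real.measurable_exp.comp ((hQ a).const_mul _)))).const_mul _

lemma measurable_bellman {Q : X → A → ℝ} (hQ : ∀ a, Measurable fun s => Q s a) (a : A) :
    Measurable fun s => M.bellman Q s a :=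
  (M.measurable_r a).add (((M.measurable_softValue hQ).stronglyMeasurable.integral_kernel
    (κ := M.p a)).measurable.const_mul _)

lemma integrable_softValue {Q : X → A → ℝ} (hQ : ∀ a, Measurable fun s => Q s a) {C : ℝ}
    (hC : ∀ s a, |Q s a| ≤ C) (μ : Measure X) [IsProbabilityMeasure μ] :
    Integrable (M.softValue Q) μ :=
  Integrable.of_mem_Icc (-C) C (M.measurable_softValue hQ).aemeasurable
    (Eventually.of_forall fun s => ⟨M.le_softValue fun a => (abs_le.1 (hC s a)).1,
      M.softValue_le fun a => (abs_le.1 (hC s a)).2⟩)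

lemma bellman_le_add {Q Q' : X → A → ℝ} (hQ : ∀ a, Measurable fun s => Q s a)
    (hQ' : ∀ a, Measurable fun s => Q' s a) {C C' D : ℝ} (hC : ∀ s a, |Q s a| ≤ C)
    (hC' : ∀ s a, |Q' s a| ≤ C') (hD : ∀ s a, Q s a ≤ Q' s a + D) (s : X) (a : A) :
    M.bellman Q s a ≤ M.bellman Q' s a + M.γ * D := by
  have h : ∫ x, M.softValue Q x ∂(M.p a s) ≤ ∫ x, M.softValue Q' x ∂(M.p a s) + D := by
    calc ∫ x, M.softValue Q x ∂(M.p a s) ≤ ∫ x, (M.softValue Q' x + D) ∂(M.p a s) :=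
          integral_mono (M.integrable_softValue hQ hC _)
            ((M.integrable_softValue hQ' hC' _).add (integrable_const D))
            fun x => M.softValue_le_add fun a => hD x a
      _ = ∫ x, M.softValue Q' x ∂(M.p a s) + D := by
          rw [integral_add (M.integrable_softValue hQ' hC' _) (integrable_const D)]
          simp
  have := mul_le_mul_of_nonneg_left h M.γ_nonneg
  simp only [bellman]
  linarith

lemma abs_bellman_le {Q : X → A → ℝ} {C : ℝ} (hr : ∀ s a, |M.r s a| ≤ (1 - M.γ) * C)
    (hC : ∀ s a, |Q s a| ≤ C) (s : X) (a : A) : |M.bellman Q s a| ≤ C := by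
  have h : |∫ x, M.softValue Q x ∂(M.p a s)| ≤ C := by
    simpa using norm_integral_le_of_norm_le_const (μ := M.p a s) (f := M.softValue Q) (C := C)
      (Eventually.of_forall fun x => abs_le.2 ⟨M.le_softValue fun a => (abs_le.1 (hC x a)).1,
        M.softValue_le fun a => (abs_le.1 (hC x a)).2⟩)
  calc |M.bellman Q s a| ≤ |M.r s a| + |M.γ * ∫ x, M.softValue Q x ∂(M.p a s)| := abs_add_le _ _
    _ ≤ (1 - M.γ) * C + M.γ * C := by
        rw [abs_mul, abs_of_nonneg M.γ_nonneg]
        exact add_le_add (hr s a) (mul_le_mul_of_nonneg_left h M.γ_nonneg)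
    _ = C := by ring

variable {M}

lemma measurable_iterate_bellman (k : ℕ) (a : A) :
    Measurable fun s => (M.bellman^[k] M.r) s a := by
  induction k generalizing a with
  | zero => exact M.measurable_r a
  | succ k ih => rw [Function.iterate_succ_apply']; exact M.measurable_bellman ih a

lemma abs_iterate_bellman_le {C : ℝ} (hr : ∀ s a, |M.r s a| ≤ (1 - M.γ) * C) (k : ℕ) (s : X)
    (a : A) : |(M.bellman^[k] M.r) s a| ≤ C := by
  induction k generalizing s a with
  | zero =>
    have hC : 0 ≤ C := nonneg_of_mul_nonneg_right ((abs_nonneg _).trans (hr s a))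
      (sub_pos.2 M.γ_lt_one)
    refine (hr s a).trans ?_
    nlinarith [M.γ_nonneg]
  | succ k ih => rw [Function.iterate_succ_apply']; exact M.abs_bellman_le hr ih s a

/-- The contraction property, as two order inequalities because `bellman_le_add` is one-sided. The
start 2C comes from all iterates lying in [-C, C]. -/
lemma iterate_bellman_diff_le {C : ℝ} (hr : ∀ s a, |M.r s a| ≤ (1 - M.γ) * C) (k : ℕ) :
    (∀ s a, (M.bellman^[k] M.r) s a ≤ (M.bellman^[k + 1] M.r) s a + 2 * C * M.γ ^ k) ∧
      ∀ s a, (M.bellman^[k + 1] M.r) s a ≤ (M.bellman^[k] M.r) s a + 2 * C * M.γ ^ k := by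
  induction k with
  | zero =>
    constructor <;> intro s a <;>
    linarith [abs_le.1 (abs_iterate_bellman_le hr 0 s a),
      abs_le.1 (abs_iterate_bellman_le hr (0 + 1) s a), pow_zero M.γ,
      congrArg (2 * C * ·) (pow_zero M.γ)]
  | succ k ih =>
    have e : 2 * C * M.γ ^ (k + 1) = M.γ * (2 * C * M.γ ^ k) := by ring
    rw [Function.iterate_succ_apply' _ (k + 1), e]
    constructor <;> intro s a
    · nth_rewrite 1 [Function.iterate_succ_apply']
      exact M.bellman_le_add (measurable_iterate_bellman k) (measurable_iterate_bellman (k + 1))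
        (abs_iterate_bellman_le hr k) (abs_iterate_bellman_le hr (k + 1)) ih.1 s a
    · nth_rewrite 2 [Function.iterate_succ_apply']
      exact M.bellman_le_add (measurable_iterate_bellman (k + 1)) (measurable_iterate_bellman k)
        (abs_iterate_bellman_le hr (k + 1)) (abs_iterate_bellman_le hr k) ih.2 s a

lemma tendsto_iterate_bellman {C : ℝ} (hr : ∀ s a, |M.r s a| ≤ (1 - M.γ) * C) (s : X) (a : A) :
    Tendsto (fun k => (M.bellman^[k] M.r) s a) atTop (nhds (M.optimalQ s a)) := by
  refine CauchySeq.tendsto_limUnder (cauchySeq_of_le_geometric M.γ (2 * C) M.γ_lt_one fun k => ?_)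
  have h := iterate_bellman_diff_le hr k
  rw [Real.dist_eq, abs_le]
  constructor <;> linarith [h.1 s a, h.2 s a]

lemma measurable_optimalQ {C : ℝ} (hr : ∀ s a, |M.r s a| ≤ (1 - M.γ) * C) (a : A) :
    Measurable fun s => M.optimalQ s a :=
  measurable_of_tendsto_metrizable (fun k => measurable_iterate_bellman k a)
    (tendsto_pi_nhds.2 fun s => tendsto_iterate_bellman hr s a)

lemma abs_optimalQ_le {C : ℝ} (hr : ∀ s a, |M.r s a| ≤ (1 - M.γ) * C) (s : X) (a : A) :
    |M.optimalQ s a| ≤ C :=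
  le_of_tendsto (tendsto_iterate_bellman hr s a).abs
    (Eventually.of_forall fun k => abs_iterate_bellman_le hr k s a)

/-- The soft Bellman equation `Q* = B Q*`. -/
lemma bellman_optimalQ {C : ℝ} (hr : ∀ s a, |M.r s a| ≤ (1 - M.γ) * C) (s : X) (a : A) :
    M.bellman M.optimalQ s a = M.optimalQ s a := by
  refine tendsto_nhds_unique (f := fun k => (M.bellman^[k + 1] M.r) s a) ?_
    ((tendsto_add_atTop_iff_nat 1).2 (tendsto_iterate_bellman hr s a))
  simp only [Function.iterate_succ_apply', bellman]
  refine (Tendsto.const_mul _ ?_).const_add _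
  refine tendsto_integral_of_dominated_convergence (fun _ => C)
    (fun k => (M.measurable_softValue (measurable_iterate_bellman k)).aestronglyMeasurable)
    (integrable_const C) (fun k => Eventually.of_forall fun x => abs_le.2
      ⟨M.le_softValue fun a => (abs_le.1 (abs_iterate_bellman_le hr k x a)).1,
        M.softValue_le fun a => (abs_le.1 (abs_iterate_bellman_le hr k x a)).2⟩)
    (Eventually.of_forall fun x => ?_)
  refine Tendsto.const_mul _ (Tendsto.log ?_ (M.sum_prior_mul_exp_pos _ x).ne')
  exact tendsto_finsetSum _ fun b _ => ((Real.continuous_exp.tendsto _).comp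
    ((tendsto_iterate_bellman hr x b).const_mul _)).const_mul _

/-- The fixed-point equation bounds the supremum U by Rmax + γU, and dually the infimum. The a
priori bound C only ensures that both are finite. -/
lemma optimalQ_mem_Icc {Rmin Rmax C : ℝ} (hr : ∀ s a, |M.r s a| ≤ (1 - M.γ) * C)
    (hR : ∀ s a, M.r s a ∈ Set.Icc Rmin Rmax) (s : X) (a : A) :
    M.optimalQ s a ∈ Set.Icc (Rmin / (1 - M.γ)) (Rmax / (1 - M.γ)) := by
  have hγ : 0 < 1 - M.γ := sub_pos.2 M.γ_lt_one
  have : Nonempty (X × A) := ⟨(s, a)⟩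
  have hle : ∀ q : X × A, M.optimalQ q.1 q.2 ≤ C := fun q =>
    (abs_le.1 (abs_optimalQ_le hr q.1 q.2)).2
  have hge : ∀ q : X × A, -C ≤ M.optimalQ q.1 q.2 := fun q =>
    (abs_le.1 (abs_optimalQ_le hr q.1 q.2)).1
  have hint := fun x b => M.integrable_softValue (measurable_optimalQ hr) (abs_optimalQ_le hr)
    (M.p b x)
  have hba : BddAbove (Set.range fun q : X × A => M.optimalQ q.1 q.2) :=
    ⟨C, by rintro _ ⟨q, rfl⟩; exact hle q⟩
  have hbb : BddBelow (Set.range fun q : X × A => M.optimalQ q.1 q.2) :=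
    ⟨-C, by rintro _ ⟨q, rfl⟩; exact hge q⟩
  set U := ⨆ q : X × A, M.optimalQ q.1 q.2 with hU
  set L := ⨅ q : X × A, M.optimalQ q.1 q.2 with hL
  have hUs : U ≤ Rmax + M.γ * U := ciSup_le fun q => by
    rw [← bellman_optimalQ hr]
    refine add_le_add (hR _ _).2 (mul_le_mul_of_nonneg_left ?_ M.γ_nonneg)
    simpa using integral_mono (hint q.1 q.2) (integrable_const U)
      fun x => M.softValue_le fun b => le_ciSup hba (x, b)
  have hLs : Rmin + M.γ * L ≤ L := le_ciInf fun q => by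
    rw [← bellman_optimalQ hr]
    refine add_le_add (hR _ _).1 (mul_le_mul_of_nonneg_left ?_ M.γ_nonneg)
    simpa using integral_mono (integrable_const L) (hint q.1 q.2)
      fun x => M.le_softValue fun b => ciInf_le hbb (x, b)
  constructor
  · refine le_trans ?_ (ciInf_le hbb (s, a))
    rw [div_le_iff₀ hγ]
    linarith
  · refine (le_ciSup hba (s, a)).trans ?_
    rw [le_div_iff₀ hγ]
    linarith

end SoftValue

/-! ### Lipschitz regularity of the soft value and of Δ. -/

section Lipschitz

variable {X A : Type*} [PseudoMetricSpace X] [MeasurableSpace X] [Fintype A]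
  {M : EntRegMDP X A} {Lr Lp Lκ LQ : ℝ≥0}

/-- Each summand is exp (log π₀ + βQ), whose exponent varies at rate Lκ + β LQ; the prefactor 1/β
gives the constant. -/
lemma IsLipschitz.lipschitzWith_softValue (hM : M.IsLipschitz Lr Lp Lκ) {Q : X → A → ℝ}
    (hQ : ∀ a, LipschitzWith LQ fun s => Q s a) :
    LipschitzWith (LQ + M.β.toNNReal⁻¹ * Lκ) (M.softValue Q) := by
  refine LipschitzWith.of_le_add_mul _ fun x y =>
    M.softValue_le_add_of_forall_mul_exp_le fun a => ?_
  have hβ := M.β_pos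
  rw [← Real.exp_log (hM.prior_pos x a), ← Real.exp_log (hM.prior_pos y a), ← Real.exp_add,
    ← Real.exp_add, Real.exp_le_exp]
  have h1 := (hM.log_prior a).le_add_mul x y
  have h2 := mul_le_mul_of_nonneg_left ((hQ a).le_add_mul x y) hβ.le
  simp only [NNReal.coe_add, NNReal.coe_mul, NNReal.coe_inv, Real.coe_toNNReal _ hβ.le]
  have h3 : M.β * ((LQ + M.β⁻¹ * Lκ) * dist x y) = M.β * (LQ * dist x y) + Lκ * dist x y := by
    field_simp
  rw [mul_add, h3]
  linarith

/-- Rescale f by 1/K to a test function. K = 0 cannot be rescaled, but f is then constant. -/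
lemma abs_integral_sub_le_of_kantorovichDist_le {μ ν : Measure X} {D K : ℝ≥0} {f : X → ℝ}
    [IsProbabilityMeasure μ] [IsProbabilityMeasure ν]
    (hD : kantorovichDist μ ν ≤ D) (hf : LipschitzWith K f) :
    |∫ x, f x ∂μ - ∫ x, f x ∂ν| ≤ K * D := by
  rcases eq_or_ne K 0 with rfl | hK
  · obtain ⟨x₀⟩ := nonempty_of_isProbabilityMeasure μ
    have hconst : ∀ x, f x = f x₀ := fun x => by
      have := hf.dist_le_mul x x₀
      simpa [sub_eq_zero] using this
    simp [hconst]
  have hKpos : (0 : ℝ) < K := by exact_mod_cast pos_iff_ne_zero.2 hK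
  have h1 : LipschitzWith 1 fun x => (K : ℝ)⁻¹ * f x := by
    refine LipschitzWith.of_dist_le_mul fun x y => ?_
    have := hf.dist_le_mul x y
    rw [Real.dist_eq] at this ⊢
    rw [← mul_sub, abs_mul, abs_of_pos (inv_pos.2 hKpos), inv_mul_le_iff₀ hKpos]
    simpa using this
  have h2 : ENNReal.ofReal |∫ x, (K : ℝ)⁻¹ * f x ∂μ - ∫ x, (K : ℝ)⁻¹ * f x ∂ν| ≤ D :=
    (le_iSup₂_of_le (f := fun (f : X → ℝ) (_ : LipschitzWith 1 f) =>
      ENNReal.ofReal |∫ x, f x ∂μ - ∫ x, f x ∂ν|) _ h1 le_rfl).trans hD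
  rw [ENNReal.ofReal_le_coe] at h2
  rwa [integral_const_mul, integral_const_mul, ← mul_sub, abs_mul, abs_of_pos (inv_pos.2 hKpos),
    inv_mul_le_iff₀ hKpos] at h2

/-- `Δ_W(x, b) = r(x, b) + γ 𝔼 W - Q(x, b)` is `L_Δ`-Lipschitz when `W` is as regular as the soft
value of `Q`. -/
lemma IsLipschitz.abs_delta_sub_le (hM : M.IsLipschitz Lr Lp Lκ) {Q : X → A → ℝ}
    (hQ : ∀ a, LipschitzWith LQ fun s => Q s a) {W : X → ℝ}
    (hW : LipschitzWith (LQ + M.β.toNNReal⁻¹ * Lκ) W) (b : A) (x y : X) :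
    |(M.r x b - Q x b + M.γ * ∫ z, W z ∂(M.p b x)) -
      (M.r y b - Q y b + M.γ * ∫ z, W z ∂(M.p b y))| ≤ M.lipDelta Lr Lp Lκ LQ * dist x y := by
  have h1 : |∫ z, W z ∂(M.p b x) - ∫ z, W z ∂(M.p b y)| ≤ _ :=
    abs_integral_sub_le_of_kantorovichDist_le (D := Lp * nndist x y)
      ((hM.dynamics b x y).trans_eq (by rw [edist_nndist, ENNReal.coe_mul])) hW
  have h2 := (hM.reward b).dist_le_mul x y
  have h3 := (hQ b).dist_le_mul x y
  rw [Real.dist_eq] at h2 h3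
  simp only [NNReal.coe_add, NNReal.coe_mul, NNReal.coe_inv, Real.coe_toNNReal _ M.β_pos.le,
    coe_nndist] at h1
  have h4 : |M.γ * (∫ z, W z ∂(M.p b x) - ∫ z, W z ∂(M.p b y))| ≤
      M.γ * ((LQ + M.β⁻¹ * Lκ) * (Lp * dist x y)) := by
    rw [abs_mul, abs_of_nonneg M.γ_nonneg]
    exact mul_le_mul_of_nonneg_left h1 M.γ_nonneg
  rw [abs_le] at *
  simp only [lipDelta]
  constructor <;> linarith [h2.1, h2.2, h3.1, h3.2, h4.1, h4.2]

end Lipschitz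

end EntRegMDP

/-! ### Comparison of V* with V, and from sampling events to bounds. -/

namespace EntRegMDP

section Comparison

variable {X A : Type*} [MeasurableSpace X] [Fintype A] (M : EntRegMDP X A)

/-- If `K` is the least constant with `vs ≤ v + K`, and `W + K` still dominates `vs`, then the
discounted expected gap between `vs` and `W` is at most `sup (ρ - q + γ 𝔼 W)`. -/
lemma exists_gap_le_delta {v vs W : X → ℝ} {q qs ρ : X → A → ℝ} {K : ℝ}
    (hfix : ∀ x b, qs x b = ρ x b + M.γ * ∫ z, vs z ∂(M.p b x))
    (hmono : ∀ C, (∀ x b, qs x b ≤ q x b + C) → ∀ x, vs x ≤ v x + C)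
    (hK : ∀ C, (∀ x, vs x ≤ v x + C) → K ≤ C) (hvsW : ∀ x, vs x ≤ W x + K)
    (hvs : ∀ b x, Integrable vs (M.p b x)) (hW : ∀ b x, Integrable W (M.p b x)) (s : X) (a : A)
    {η : ℝ} (hη : 0 < η) :
    ∃ x b, (1 - M.γ) * (∫ z, vs z ∂(M.p a s) - ∫ z, W z ∂(M.p a s)) - η ≤
      ρ x b - q x b + M.γ * ∫ z, W z ∂(M.p b x) := by
  have hγ : 0 < 1 - M.γ := sub_pos.2 M.γ_lt_one
  have hint : ∀ b x, ∫ z, vs z ∂(M.p b x) ≤ ∫ z, W z ∂(M.p b x) + K := fun b x => by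
    calc ∫ z, vs z ∂(M.p b x) ≤ ∫ z, (W z + K) ∂(M.p b x) :=
          integral_mono (hvs b x) ((hW b x).add (integrable_const K)) hvsW
      _ = ∫ z, W z ∂(M.p b x) + K := by
          rw [integral_add (hW b x) (integrable_const K)]; simp
  -- With g the gap, a failure everywhere gives qs ≤ q + (1 - γ)g - η + γK. Minimality then bounds K
  -- by this constant, which is at most K - η because g ≤ K.
  by_contra! hcon
  have h1 := mul_le_mul_of_nonneg_left (hint a s) hγ.le
  have h2 := hK _ (hmono ((1 - M.γ) * (∫ z, vs z ∂(M.p a s) - ∫ z, W z ∂(M.p a s)) - η +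
    M.γ * K) fun x b => by
      rw [hfix]
      have := mul_le_mul_of_nonneg_left (hint b x) M.γ_nonneg
      linarith [hcon x b])
  linarith

/-- The same with `W` a truncation of `v` from above, whose oscillation is at most that
of `vs`. -/
lemma exists_truncation_gap_le_delta [PseudoEMetricSpace X] [OpensMeasurableSpace X]
    {v vs : X → ℝ} {q qs ρ : X → A → ℝ} {L : ℝ≥0} (hv : LipschitzWith L v) {C c R : ℝ}
    (hvC : ∀ x, |v x| ≤ C) (hvsm : Measurable vs) (hvsI : ∀ x, vs x ∈ Set.Icc c (c + R))
    (hfix : ∀ x b, qs x b = ρ x b + M.γ * ∫ z, vs z ∂(M.p b x))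
    (hmono : ∀ C, (∀ x b, qs x b ≤ q x b + C) → ∀ x, vs x ≤ v x + C) (s : X) (a : A) :
    ∃ W : X → ℝ, LipschitzWith L W ∧ (∀ x, W x ≤ v x) ∧ (∀ x y, W x - W y ≤ R) ∧
      ∀ η > 0, ∃ x b, (1 - M.γ) * (∫ z, vs z ∂(M.p a s) - ∫ z, W z ∂(M.p a s)) - η ≤
        ρ x b - q x b + M.γ * ∫ z, W z ∂(M.p b x) := by
  have : Nonempty X := ⟨s⟩
  have hbdd : BddAbove (Set.range fun x => vs x - v x) := ⟨c + R + C, by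
    rintro _ ⟨x, rfl⟩
    have := abs_le.1 (hvC x)
    have := hvsI x
    show vs x - v x ≤ _
    linarith [this.2]⟩
  set K := ⨆ x, (vs x - v x) with hKdef
  have hvK : ∀ x, vs x ≤ v x + K := fun x => by linarith [le_ciSup hbdd x]
  -- The floor c - K comes from v ≥ vs - K ≥ c - K. The cap c + R - K is harmless for vs ≤ W + K,
  -- since vs ≤ c + R.
  have hWI : ∀ x, min (v x) (c + R - K) ∈ Set.Icc (c - K) (c - K + R) := fun x =>
    ⟨le_min (by linarith [hvK x, (hvsI x).1]) (by linarith [(hvsI x).1, (hvsI x).2]),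
      (min_le_right _ _).trans_eq (by ring)⟩
  have hWL : LipschitzWith L fun x => min (v x) (c + R - K) := hv.min_const _
  refine ⟨fun x => min (v x) (c + R - K), hWL, fun x => min_le_left _ _,
    fun x y => by linarith [(hWI x).2, (hWI y).1], fun η hη => ?_⟩
  refine M.exists_gap_le_delta (K := K) hfix hmono
    (fun C hC => ciSup_le fun x => by linarith [hC x]) (fun x => ?_)
    (fun b x => Integrable.of_mem_Icc c (c + R) hvsm.aemeasurable (Eventually.of_forall hvsI))
    (fun b x => Integrable.of_mem_Icc _ _ hWL.continuous.measurable.aemeasurable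
      (Eventually.of_forall hWI)) s a hη
  rw [← min_add_add_right]
  exact le_min (hvK x) (by linarith [(hvsI x).2])

/-- The samples for which the batch does not detect `h + γ 𝔼 W ≥ τ`, or the empirical mean of `W`
at `(s, a)` is too small. -/
def samplingFailure (h : X → A → ℝ) (W : X → ℝ) (τ ε : ℝ) (N n : ℕ) (s : X) (a : A) :
    Set (SampleSpace X A N n) :=
  {ω | (∀ i b, h (ω.1 i).1 b + M.γ * (1 / (n : ℝ) * ∑ j, W ((ω.1 i).2 b j)) < τ - M.γ * ε) ∨
    1 / (n : ℝ) * ∑ j, W (ω.2 j) < ∫ z, W z ∂(M.p a s) - ε}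

variable {M} {h : X → A → ℝ} {W : X → ℝ} {ε₁ ε₂ τ : ℝ} {N n : ℕ} {s : X} {a : A}

/-- A single ε₂ pays for both mean errors: the batch loses γε₂, and the remaining (1 - γ)ε₂, divided
by 1 - γ, absorbs the error ε₂ at (s, a). -/
lemma exists_bound_of_notMem_samplingFailure {ω : SampleSpace X A N n} {g : ℝ}
    (hω : ω ∉ M.samplingFailure h W ((1 - M.γ) * (g - ∫ z, W z ∂(M.p a s)) - ε₁) ε₂ N n s a) :
    ∃ i b, M.γ * g ≤ M.γ * (1 / (n : ℝ) * ∑ j, W (ω.2 j) +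
      (h (ω.1 i).1 b + M.γ * (1 / (n : ℝ) * ∑ j, W ((ω.1 i).2 b j)) + (ε₁ + ε₂)) /
        (1 - M.γ)) := by
  simp only [samplingFailure, Set.mem_ofPred_eq, not_or, not_forall, not_lt] at hω
  obtain ⟨⟨i, b, h1⟩, h2⟩ := hω
  have hγ : 0 < 1 - M.γ := sub_pos.2 M.γ_lt_one
  refine ⟨i, b, mul_le_mul_of_nonneg_left ?_ M.γ_nonneg⟩
  have h3 : g - ∫ z, W z ∂(M.p a s) + ε₂ ≤
      (h (ω.1 i).1 b + M.γ * (1 / (n : ℝ) * ∑ j, W ((ω.1 i).2 b j)) + (ε₁ + ε₂)) /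
        (1 - M.γ) := by
    rw [le_div_iff₀ hγ]
    linarith
  linarith

/-- The bound increases with the sampled values, both directly and through `batchMax`, so replacing
W by the larger soft value keeps it. -/
lemma upperBound_of_notMem_samplingFailure {Q : X → A → ℝ}
    (hfix : M.bellman M.optimalQ s a = M.optimalQ s a) (hW : ∀ x, W x ≤ M.softValue Q x)
    {ω : SampleSpace X A N n}
    (hω : ω ∉ M.samplingFailure (fun x b => M.r x b - Q x b) W
      ((1 - M.γ) * (∫ z, M.softValue M.optimalQ z ∂(M.p a s) - ∫ z, W z ∂(M.p a s)) - ε₁)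
      ε₂ N n s a) : M.UpperBound Q s a (ε₁ + ε₂) ω := by
  obtain ⟨i, b, hb⟩ := exists_bound_of_notMem_samplingFailure hω
  have hγ : 0 < 1 - M.γ := sub_pos.2 M.γ_lt_one
  have hmean : ∀ y : Fin n → X, 1 / (n : ℝ) * ∑ j, W (y j) ≤ M.empValue Q y := fun y =>
    mul_le_mul_of_nonneg_left (Finset.sum_le_sum fun j _ => hW _) (by positivity)
  have hmax : M.empDelta Q (ω.1 i).1 b ((ω.1 i).2 b) ≤ M.batchMax Q ω :=
    le_ciSup (f := fun k : Fin N × A => M.empDelta Q (ω.1 k.1).1 k.2 ((ω.1 k.1).2 k.2))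
      (Set.finite_range _).bddAbove (i, b)
  have h1 := mul_le_mul_of_nonneg_left (hmean ((ω.1 i).2 b)) M.γ_nonneg
  rw [UpperBound, ← hfix, bellman]
  refine add_le_add le_rfl (hb.trans (mul_le_mul_of_nonneg_left
    (add_le_add (hmean _) (div_le_div_of_nonneg_right ?_ hγ.le)) M.γ_nonneg))
  rw [empDelta] at hmax
  linarith

lemma lowerBound_of_notMem_samplingFailure {Q : X → A → ℝ}
    (hfix : M.bellman M.optimalQ s a = M.optimalQ s a) (hW : ∀ x, W x ≤ -M.softValue Q x)
    {ω : SampleSpace X A N n}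
    (hω : ω ∉ M.samplingFailure (fun x b => -M.r x b - -Q x b) W
      ((1 - M.γ) * (∫ z, -M.softValue M.optimalQ z ∂(M.p a s) - ∫ z, W z ∂(M.p a s)) - ε₁)
      ε₂ N n s a) : M.LowerBound Q s a (ε₁ + ε₂) ω := by
  obtain ⟨i, b, hb⟩ := exists_bound_of_notMem_samplingFailure hω
  have hγ : 0 < 1 - M.γ := sub_pos.2 M.γ_lt_one
  have hmean : ∀ y : Fin n → X, 1 / (n : ℝ) * ∑ j, W (y j) ≤ -M.empValue Q y := fun y => by
    rw [empValue, ← mul_neg, ← Finset.sum_neg_distrib]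
    exact mul_le_mul_of_nonneg_left (Finset.sum_le_sum fun j _ => hW _) (by positivity)
  have hmin : M.batchMin Q ω ≤ M.empDelta Q (ω.1 i).1 b ((ω.1 i).2 b) :=
    ciInf_le (f := fun k : Fin N × A => M.empDelta Q (ω.1 k.1).1 k.2 ((ω.1 k.1).2 k.2))
      (Set.finite_range _).bddBelow (i, b)
  have h1 := mul_le_mul_of_nonneg_left (hmean ((ω.1 i).2 b)) M.γ_nonneg
  rw [integral_neg] at hb
  have h2 : M.γ * -∫ z, M.softValue M.optimalQ z ∂(M.p a s) ≤
      M.γ * (-M.empValue Q ω.2 + -(M.batchMin Q ω - (ε₁ + ε₂)) / (1 - M.γ)) := by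
    refine hb.trans (mul_le_mul_of_nonneg_left
      (add_le_add (hmean _) (div_le_div_of_nonneg_right ?_ hγ.le)) M.γ_nonneg)
    rw [empDelta] at hmin
    linarith
  rw [LowerBound, ← hfix, bellman]
  rw [neg_div] at h2
  linarith

end Comparison

/-! ### Probability of sampling failure and coverage of level sets. -/

section Sampling

variable {d : ℕ} {S : Set (EuclideanSpace ℝ (Fin d))} {A : Type*} [Fintype A]

instance isProbabilityMeasure_sampleLaw (M : EntRegMDP S A) (N n : ℕ) (s : S) (a : A)
    [IsProbabilityMeasure (uniformState S)] : IsProbabilityMeasure (M.sampleLaw N n s a) := by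
  unfold sampleLaw
  infer_instance

/-- Union bound: the batch and the samples at (s, a) contribute δ/2 each. -/
lemma sampleLaw_real_samplingFailure_le (M : EntRegMDP S A)
    [IsProbabilityMeasure (uniformState S)] {W : S → ℝ} (hW : Measurable W) {h : S → A → ℝ}
    (hh : ∀ b, Measurable fun x => h x b) {R ε δ : ℝ} (hosc : ∀ x y, W x - W y ≤ R)
    (hε : 0 < ε) (hδ : 0 < δ) (hδ₂ : δ ≤ 2) (N : ℕ) {n : ℕ} (hn₀ : 1 ≤ n)
    (hn : 1 / 2 * (R / ε) ^ 2 * Real.log (2 / δ) ≤ n) (τ : ℝ) (s : S) (a : A) :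
    (M.sampleLaw N n s a).real (M.samplingFailure h W τ ε N n s a) ≤
      (uniformState S).real {x | ∀ b, h x b + M.γ * ∫ z, W z ∂(M.p b x) < τ} ^ N + δ := by
  set E₁ : Set (Fin N → S × (A → Fin n → S)) := {z | ∀ i b, h (z i).1 b +
    M.γ * (1 / (n : ℝ) * ∑ j, W ((z i).2 b j)) < τ - M.γ * ε} with hE₁
  set E₂ : Set (Fin n → S) := {y | 1 / (n : ℝ) * ∑ j, W (y j) < ∫ z, W z ∂(M.p a s) - ε} with hE₂
  have hsub : M.samplingFailure h W τ ε N n s a = E₁ ×ˢ Set.univ ∪ Set.univ ×ˢ E₂ := by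
    ext ω; simp [samplingFailure, hE₁, hE₂]
  rw [hsub]
  refine (measureReal_union_le _ _).trans ?_
  have h1 : (M.sampleLaw N n s a).real (E₁ ×ˢ Set.univ) = _ := measureReal_prod_prod _ _
  have h2 : (M.sampleLaw N n s a).real (Set.univ ×ˢ E₂) = _ := measureReal_prod_prod _ _
  rw [h1, h2, probReal_univ, probReal_univ, mul_one, one_mul]
  have h3 := M.pi_real_batch_lt_le (uniformState S) hW hh hosc hε hδ hδ₂ N hn₀ hn τ
  have h4 := pi_real_mean_lt_le (M.p a s) hW hosc hε hδ hn₀ hn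
  linarith

end Sampling

end EntRegMDP

lemma le_measureReal_of_compl_subset {Ω : Type*} [MeasurableSpace Ω] {μ : Measure Ω}
    [IsProbabilityMeasure μ] {G E : Set Ω} {c : ℝ} (hsub : ∀ ω ∉ E, ω ∈ G) (hE : μ.real E ≤ c) :
    1 - c ≤ μ.real G := by
  have h : μ.real Set.univ ≤ μ.real G + μ.real E :=
    (measureReal_mono fun ω _ => by
      by_cases hω : ω ∈ E
      · exact Or.inr hω
      · exact Or.inl (hsub ω hω)).trans (measureReal_union_le G E)
  rw [probReal_univ] at h
  linarith

section Coverage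

variable {d : ℕ} {S : Set (EuclideanSpace ℝ (Fin d))} {A : Type*} [Fintype A]

lemma continuous_of_abs_sub_le_mul_dist {X : Type*} [PseudoMetricSpace X] {f : X → ℝ} {L : ℝ}
    (hL : 0 ≤ L) (hf : ∀ x y, |f x - f y| ≤ L * dist x y) : Continuous f :=
  (LipschitzWith.of_dist_le_mul (K := ⟨L, hL⟩) fun x y => by
    rw [Real.dist_eq]; exact hf x y).continuous

/-- The batch misses the `ε`-superlevel set of `max_b F(·, b)` at a level `w` below its supremum
with probability at most `δ`. -/
lemma uniformState_real_forall_lt_pow_le (hS_bdd : Bornology.IsBounded S) (hS_conv : Convex ℝ S)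
    (hS_int : (interior S).Nonempty) (hS_meas : MeasurableSet S) {L ε δ w : ℝ} (hL : 0 ≤ L)
    (hε : 0 < ε) (hδ : 0 < δ) {N : ℕ} (hN₀ : 1 ≤ N)
    (hN : (L * Metric.diam S / ε) ^ d * Real.log (1 / δ) ≤ N) {F : S → A → ℝ}
    (hF : ∀ b x y, |F x b - F y b| ≤ L * dist x y) (hw : ∀ η > 0, ∃ x b, w - η ≤ F x b) :
    (uniformState S).real {x | ∀ b, F x b < w - ε} ^ N ≤ δ := by
  have := isProbabilityMeasure_uniformState hS_bdd hS_int hS_meas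
  have hFm : ∀ b, Measurable fun x => F x b := fun b =>
    (continuous_of_abs_sub_le_mul_dist hL (hF b)).measurable
  have hm : MeasurableSet {x | ∀ b, F x b < w - ε} := by
    simp only [Set.ofPred_forall]
    exact MeasurableSet.iInter fun b => measurableSet_lt (hFm b) measurable_const
  have key := one_sub_uniformState_real_pow_le hS_bdd hS_conv hS_int hS_meas hL hε hδ hN₀ hN
    (T := {x | ∀ b, F x b < w - ε}ᶜ) fun η hη => by
      obtain ⟨x₀, b, hb⟩ := hw η hη
      refine ⟨x₀, fun x hx hlt => ?_⟩
      have h1 := (abs_le.1 (hF b x x₀)).1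
      have h2 : F x b < w - ε := hlt b
      linarith
  rwa [probReal_compl_eq_one_sub hm, sub_sub_cancel] at key

/-- The batch misses the `ε`-superlevel set of `max_b F(·, b)` or the `ε`-sublevel set of
`min_b F(·, b)`, at a common level `w`, with probability at most `δ`: by connectedness the two
sets overlap near a point where both are reached, and together they cover `S`. -/
lemma uniformState_real_forall_lt_pow_add_pow_le (hS_bdd : Bornology.IsBounded S)
    (hS_conv : Convex ℝ S) (hS_int : (interior S).Nonempty) (hS_meas : MeasurableSet S)
    {L ε δ w : ℝ} (hL : 0 ≤ L) (hε : 0 < ε) (hδ : 0 < δ) {N : ℕ} (hN₀ : 1 ≤ N)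
    (hN : (L * Metric.diam S / ε) ^ d * Real.log (1 / δ) ≤ N) [Nonempty A] {F : S → A → ℝ}
    (hF : ∀ b x y, |F x b - F y b| ≤ L * dist x y) (hge : ∀ η > 0, ∃ x b, w - η ≤ F x b)
    (hle : ∀ η > 0, ∃ x b, F x b ≤ w + η) :
    (uniformState S).real {x | ∀ b, F x b < w - ε} ^ N +
      (uniformState S).real {x | ∀ b, w + ε < F x b} ^ N ≤ δ := by
  have := isProbabilityMeasure_uniformState hS_bdd hS_int hS_meas
  have : PreconnectedSpace S := isPreconnected_iff_preconnectedSpace.1 hS_conv.isPreconnected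
  have hFc : ∀ b, Continuous fun x => F x b := fun b =>
    continuous_of_abs_sub_le_mul_dist hL (hF b)
  set B₁ : Set S := {x | ∀ b, F x b < w - ε} with hB₁
  set B₂ : Set S := {x | ∀ b, w + ε < F x b} with hB₂
  have hm₁ : MeasurableSet B₁ := by
    simp only [hB₁, Set.ofPred_forall]
    exact MeasurableSet.iInter fun b => measurableSet_lt (hFc b).measurable measurable_const
  have hm₂ : MeasurableSet B₂ := by
    simp only [hB₂, Set.ofPred_forall]
    exact MeasurableSet.iInter fun b => measurableSet_lt measurable_const (hFc b).measurable
  have hdisj : Disjoint B₁ B₂ := Set.disjoint_left.2 fun x h₁ h₂ => by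
    obtain ⟨b⟩ := ‹Nonempty A›
    have h₁ : F x b < w - ε := h₁ b
    have h₂ : w + ε < F x b := h₂ b
    linarith
  have key := one_sub_uniformState_real_pow_le hS_bdd hS_conv hS_int hS_meas hL hε hδ hN₀ hN
    (T := (B₁ ∪ B₂)ᶜ) fun η hη => by
      obtain ⟨x₀, ⟨b, hb⟩, c, hc⟩ := exists_point_ge_and_le hFc hge hle hη
      refine ⟨x₀, fun x hx hlt => ?_⟩
      rcases hlt with hlt | hlt
      · have h1 := (abs_le.1 (hF b x x₀)).1
        have h2 : F x b < w - ε := hlt b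
        linarith
      · have h1 := (abs_le.1 (hF c x x₀)).2
        have h2 : w + ε < F x c := hlt c
        linarith
  rw [probReal_compl_eq_one_sub (hm₁.union hm₂), sub_sub_cancel,
    measureReal_union hdisj hm₂] at key
  -- Superadditivity, u ^ N + v ^ N ≤ (u + v) ^ N for N ≥ 1, charges both bad sets to one δ.
  exact (pow_add_pow_le measureReal_nonneg measureReal_nonneg (by omega)).trans key

lemma exists_abs_le_of_lipschitzWith (hS_bdd : Bornology.IsBounded S) {f : S → ℝ} {K : ℝ≥0}
    (hf : LipschitzWith K f) (s : S) : ∃ C, ∀ x, |f x| ≤ C := by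
  refine ⟨|f s| + K * Metric.diam S, fun x => ?_⟩
  have h1 := hf.dist_le_mul x s
  rw [Real.dist_eq] at h1
  have h2 : dist x s ≤ Metric.diam S := Metric.dist_le_diam_of_mem hS_bdd x.2 s.2
  have h3 := mul_le_mul_of_nonneg_left h2 K.coe_nonneg
  have h4 := abs_add_le (f s) (f x - f s)
  rw [add_sub_cancel] at h4
  linarith

end Coverage

/-! ### The sampled bounds on Q*. -/

theorem mainTheorem4 {d : ℕ} {S : Set (EuclideanSpace ℝ (Fin d))} {A : Type*} [Fintype A]
    (hS_bdd : Bornology.IsBounded S) (hS_conv : Convex ℝ S) (hS_int : (interior S).Nonempty)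
    (hS_meas : MeasurableSet S)
    (M : EntRegMDP S A) (Q : S → A → ℝ) (Lr Lp Lκ LQ : ℝ≥0)
    (hM : M.IsLipschitz Lr Lp Lκ) (hQ : ∀ a, LipschitzWith LQ fun s => Q s a)
    (Rmin Rmax : ℝ) (hR : ∀ s a, M.r s a ∈ Set.Icc Rmin Rmax)
    (ε₁ ε₂ δ₁ δ₂ : ℝ) (hε₁ : 0 < ε₁) (hε₂ : 0 < ε₂) (hδ₁ : 0 < δ₁) (hδ₂ : 0 < δ₂)
    (N n : ℕ) (hN₀ : 1 ≤ N) (hn₀ : 1 ≤ n)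
    (hN : (M.lipDelta Lr Lp Lκ LQ * Metric.diam S / ε₁) ^ d * Real.log (1 / δ₁) ≤ N)
    (hn : 1 / 2 * ((Rmax - Rmin) / (ε₂ * (1 - M.γ))) ^ 2 * Real.log (2 / δ₂) ≤ n)
    (s : S) (a : A) :
    (1 - δ₁ - 2 * δ₂ ≤ (M.sampleLaw N n s a).real {ω | M.UpperBound Q s a (ε₁ + ε₂) ω} ∧
      1 - δ₁ - 2 * δ₂ ≤ (M.sampleLaw N n s a).real {ω | M.LowerBound Q s a (ε₁ + ε₂) ω}) ∧
    ((∀ x y, M.softValue Q x - M.softValue Q y ≤ (Rmax - Rmin) / (1 - M.γ)) →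
      1 - δ₁ - 2 * δ₂ ≤ (M.sampleLaw N n s a).real
        {ω | M.UpperBound Q s a (ε₁ + ε₂) ω ∧ M.LowerBound Q s a (ε₁ + ε₂) ω}) := by
  have := isProbabilityMeasure_uniformState hS_bdd hS_int hS_meas
  have : Nonempty A := ⟨a⟩
  -- The convexity estimate uses δ₂/2 as a weight, hence needs δ₂ ≤ 2; beyond that the claim is
  -- void.
  rcases lt_or_ge 2 δ₂ with hδ | hδ
  · have htriv : 1 - δ₁ - 2 * δ₂ ≤ 0 := by linarith
    exact ⟨⟨htriv.trans measureReal_nonneg, htriv.trans measureReal_nonneg⟩,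
      fun _ => htriv.trans measureReal_nonneg⟩
  have hγ : 0 < 1 - M.γ := sub_pos.2 M.γ_lt_one
  set R := (Rmax - Rmin) / (1 - M.γ) with hRdef
  have hn' : 1 / 2 * (R / ε₂) ^ 2 * Real.log (2 / δ₂) ≤ n := by
    rwa [hRdef, div_div, mul_comm (1 - M.γ)]
  have hr : ∀ s a, |M.r s a| ≤ (1 - M.γ) * (max |Rmin| |Rmax| / (1 - M.γ)) := fun s a => by
    rw [mul_div_cancel₀ _ hγ.ne']
    exact abs_le_max_abs_abs (hR s a).1 (hR s a).2
  have hfix := EntRegMDP.bellman_optimalQ hr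
  have hVsm := M.measurable_softValue (EntRegMDP.measurable_optimalQ hr)
  have hVsI : ∀ x, M.softValue M.optimalQ x ∈ Set.Icc (Rmin / (1 - M.γ)) (Rmax / (1 - M.γ)) :=
    fun x => ⟨M.le_softValue fun b => (EntRegMDP.optimalQ_mem_Icc hr hR x b).1,
      M.softValue_le fun b => (EntRegMDP.optimalQ_mem_Icc hr hR x b).2⟩
  have hRmax : Rmin / (1 - M.γ) + R = Rmax / (1 - M.γ) := by rw [hRdef]; ring
  have hRmin : -(Rmax / (1 - M.γ)) + R = -(Rmin / (1 - M.γ)) := by rw [hRdef]; ring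
  set V := M.softValue Q with hV
  set Vs := M.softValue M.optimalQ with hVs
  have hVL : LipschitzWith _ V := hM.lipschitzWith_softValue hQ
  obtain ⟨C, hC⟩ := exists_abs_le_of_lipschitzWith hS_bdd hVL s
  have hL : 0 ≤ M.lipDelta Lr Lp Lκ LQ := by
    have := M.β_pos
    have := M.γ_nonneg
    unfold EntRegMDP.lipDelta
    positivity
  have hrQ : ∀ b, Measurable fun x => M.r x b - Q x b := fun b =>
    (M.measurable_r b).sub (hQ b).continuous.measurable
  have hrQ' : ∀ b, Measurable fun x => -M.r x b - -Q x b := fun b =>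
    (M.measurable_r b).neg.sub (hQ b).continuous.measurable.neg
  have hmono : ∀ C, (∀ x b, M.optimalQ x b ≤ Q x b + C) → ∀ x, Vs x ≤ V x + C :=
    fun C h x => M.softValue_le_add (h x)
  have hmono' : ∀ C, (∀ x b, -M.optimalQ x b ≤ -Q x b + C) → ∀ x, -Vs x ≤ -V x + C :=
    fun C h x => by
      have : V x ≤ Vs x + C := M.softValue_le_add fun b => by linarith [h x b]
      linarith
  have hfixU : ∀ x b, M.optimalQ x b = M.r x b + M.γ * ∫ z, Vs z ∂(M.p b x) :=
    fun x b => (hfix x b).symm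
  have hfixL : ∀ x b, -M.optimalQ x b = -M.r x b + M.γ * ∫ z, -Vs z ∂(M.p b x) := fun x b => by
    rw [hfixU, integral_neg]; ring
  have hVC' : ∀ x, |-V x| ≤ C := fun x => (abs_neg _).trans_le (hC x)
  have hVLn : LipschitzWith _ fun x => -V x := hVL.neg
  refine ⟨⟨?_, ?_⟩, fun hosc => ?_⟩
  · obtain ⟨W, hWL, hWV, hWosc, hgap⟩ := M.exists_truncation_gap_le_delta (R := R) hVL hC hVsm
      (fun x => by rw [hRmax]; exact hVsI x) hfixU hmono s a
    rw [sub_sub]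
    refine le_measureReal_of_compl_subset
      (fun ω => EntRegMDP.upperBound_of_notMem_samplingFailure (hfix s a) hWV)
      ((M.sampleLaw_real_samplingFailure_le hWL.continuous.measurable hrQ hWosc hε₂ hδ₂ hδ N hn₀
        hn' _ s a).trans ?_)
    have := uniformState_real_forall_lt_pow_le hS_bdd hS_conv hS_int hS_meas hL hε₁ hδ₁ hN₀ hN
      (fun b x y => hM.abs_delta_sub_le hQ hWL b x y) hgap
    linarith
  -- The sign-reversed problem: the truncation of -V from above amounts to one of V from below.
  · obtain ⟨W, hWL, hWV, hWosc, hgap⟩ := M.exists_truncation_gap_le_delta (R := R) hVLn hVC'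
      (vs := fun z => -Vs z) hVsm.neg (fun x => by
        rw [hRmin]; exact ⟨neg_le_neg (hVsI x).2, neg_le_neg (hVsI x).1⟩) hfixL hmono' s a
    rw [sub_sub]
    refine le_measureReal_of_compl_subset
      (fun ω => EntRegMDP.lowerBound_of_notMem_samplingFailure (hfix s a) hWV)
      ((M.sampleLaw_real_samplingFailure_le hWL.continuous.measurable hrQ' hWosc hε₂ hδ₂ hδ N hn₀
        hn' _ s a).trans ?_)
    have := uniformState_real_forall_lt_pow_le hS_bdd hS_conv hS_int hS_meas hL hε₁ hδ₁ hN₀ hN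
      (F := fun x b => -M.r x b - -Q x b + M.γ * ∫ z, W z ∂(M.p b x))
      (fun b x y => by
        have h := hM.abs_delta_sub_le hQ (W := fun x => -W x) hWL.neg b x y
        simp only [integral_neg] at h
        rw [← abs_neg] at h
        refine le_of_eq_of_le (congrArg _ ?_) h
        ring) hgap
    linarith
  -- No truncation here: the two one-sided truncations differ in general, and the shared δ₁ requires
  -- the same Δ on both sides.
  · have hVi : ∀ b x, Integrable V (M.p b x) := fun b x =>
      Integrable.of_mem_Icc (-C) C hVL.continuous.measurable.aemeasurable
        (Eventually.of_forall fun z => abs_le.1 (hC z))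
    have hVsi : ∀ b x, Integrable Vs (M.p b x) := fun b x =>
      Integrable.of_mem_Icc _ _ hVsm.aemeasurable (Eventually.of_forall hVsI)
    have : Nonempty S := ⟨s⟩
    have hC' : ∀ z, |Vs z - V z| ≤ max |Rmin / (1 - M.γ)| |Rmax / (1 - M.γ)| + C := fun z =>
      (abs_sub _ _).trans (add_le_add (abs_le_max_abs_abs (hVsI z).1 (hVsI z).2) (hC z))
    have hba : BddAbove (Set.range fun z => Vs z - V z) :=
      ⟨_, by rintro _ ⟨z, rfl⟩; exact (abs_le.1 (hC' z)).2⟩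
    have hba' : BddAbove (Set.range fun z => -Vs z - -V z) :=
      ⟨max |Rmin / (1 - M.γ)| |Rmax / (1 - M.γ)| + C, by
        rintro _ ⟨z, rfl⟩
        have := (abs_le.1 (hC' z)).1
        show -Vs z - -V z ≤ _
        linarith⟩
    have hgap := fun η (hη : η > 0) => M.exists_gap_le_delta (K := ⨆ z, (Vs z - V z)) hfixU hmono
      (fun C hC => ciSup_le fun x => by linarith [hC x])
      (fun x => by linarith [le_ciSup hba x]) hVsi hVi s a hη
    have hgap' := fun η (hη : η > 0) => M.exists_gap_le_delta (K := ⨆ z, (-Vs z - -V z))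
      (vs := fun z => -Vs z) (W := fun z => -V z) hfixL hmono' (fun C hC => ciSup_le fun x => by linarith [hC x])
      (fun x => by linarith [le_ciSup hba' x]) (fun b x => (hVsi b x).neg)
      (fun b x => (hVi b x).neg) s a hη
    have hU := M.sampleLaw_real_samplingFailure_le (h := fun x b => M.r x b - Q x b)
      hVL.continuous.measurable hrQ hosc hε₂ hδ₂ hδ N hn₀ hn'
      ((1 - M.γ) * (∫ z, Vs z ∂(M.p a s) - ∫ z, V z ∂(M.p a s)) - ε₁) s a
    have hLo := M.sampleLaw_real_samplingFailure_le (h := fun x b => -M.r x b - -Q x b)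
      (W := fun x => -V x) (R := R) hVLn.continuous.measurable hrQ'
      (fun x y => by linarith [hosc y x]) hε₂ hδ₂ hδ N hn₀ hn'
      ((1 - M.γ) * (∫ z, -Vs z ∂(M.p a s) - ∫ z, -V z ∂(M.p a s)) - ε₁) s a
    have hcov := uniformState_real_forall_lt_pow_add_pow_le hS_bdd hS_conv hS_int hS_meas hL hε₁
      hδ₁ hN₀ hN (fun b x y => hM.abs_delta_sub_le hQ hVL b x y) hgap fun η hη => by
        obtain ⟨x, b, hb⟩ := hgap' η hη
        simp only [integral_neg] at hb
        exact ⟨x, b, by linarith⟩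
    -- In terms of Δ_V, the bad set of the reversed problem is where Δ_V exceeds w + ε₁ for every
    -- action, as `hcov` requires.
    have hset : {x : S | ∀ b, -M.r x b - -Q x b + M.γ * ∫ z, -V z ∂(M.p b x) <
          (1 - M.γ) * (∫ z, -Vs z ∂(M.p a s) - ∫ z, -V z ∂(M.p a s)) - ε₁} =
        {x | ∀ b, (1 - M.γ) * (∫ z, Vs z ∂(M.p a s) - ∫ z, V z ∂(M.p a s)) + ε₁ <
          M.r x b - Q x b + M.γ * ∫ z, V z ∂(M.p b x)} := by
      ext x
      simp only [integral_neg, Set.mem_ofPred_eq]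
      refine forall_congr' fun b => ?_
      constructor <;> intro h <;> linarith
    rw [hset] at hLo
    rw [sub_sub]
    refine le_measureReal_of_compl_subset (fun ω hω => ⟨
      EntRegMDP.upperBound_of_notMem_samplingFailure (hfix s a) (fun _ => le_rfl)
        fun h => hω (Or.inl h),
      EntRegMDP.lowerBound_of_notMem_samplingFailure (hfix s a) (fun _ => le_rfl)
        fun h => hω (Or.inr h)⟩)
      ((measureReal_union_le _ _).trans ?_)
    linarith
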